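/- Let $n,m\ge 0$ be integers, let $p\ge 2$ be an even integer, let $T=[t_0,t_f]$ with $t_0<t_f$, and let $Y=\{y\in\mathbb R^n:\ g^Y_i(y)\ge 0,\ i=1,\dots,n_Y\}$ with $g^Y_i\in\mathbb R[y]$. Let $y_0,y_f\in Y$ be prescribed boundary states. Let $l\in\mathbb R[t,y,u]$ and $f=(f_1,\dots,f_n)\in\mathbb R[t,y,u]^n$, $u=(u_1,\dots,u_m)$, have degree at most $p$ in $u$. Let $\hat l,\hat f_k\in\mathbb R[t,y,w_0,w]$, $w=(w_1,\dots,w_m)$, be their homogenizations with respect to the control: each term $c\,t^a y^b u^\kappa$ is replaced by $c\,t^a y^b\, w_0^{\,p-|\kappa|}\,w^\kappa$. Put $$W=\Big\{(w_0,w)\in[0,1]\times\mathbb R^m:\ \sum_{i=1}^m|w_i|^p\le 1,\ w_0^p=1-\sum_{i=1}^m w_i^p\Big\},\qquad G=T\times Y\times W\subset\mathbb R^{1+n+1+m}.$$ Let $g_1,\dots,g_N\in\mathbb R[t,y,w_0,w]$ be any polynomials with $G=\{g_i\ge 0,\ i=1,\dots,N\}$ such that one of them is of the form $r-\|(t,y,w_0,w)\|_2^2$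 with $r\in\mathbb R$ (so that $G$ and $Y$ are compact), and put $g_0:=1$. The measure LP is $$p_W^*=\inf_\gamma \int \hat l\,d\gamma\quad\text{s.t.}\quad \int\Big(\frac{\partial v}{\partial t}\,w_0^p+\frac{\partial v}{\partial y}\,\hat f\Big)\,d\gamma=v(t_f,y_f)-v(t_0,y_0)\quad\forall v\in C^1(T\times Y),$$ over all finite nonnegative Borel measures $\gamma$ supported on $G$, where $C^1(T\times Y)$ means the restrictions to $T\times Y$ of continuously differentiable functions $v:\mathbb R\times\mathbb R^n\to\mathbb R$, with the derivatives of these functions. For a real sequence $z=(z_\beta)_{\beta\in\mathbb N^{1+n+1+m}}$ let $\ell_z\big(\sum_\beta q_\beta x^\beta\big)=\sum_\beta q_\beta z_\beta$, where $x=(t,y,w_0,w)$, and for a polynomial $g$ and $d\in\mathbb N$ let $M_d(g\,z)$ be the localizing matrix with entries $\ell_z(g\,x^{\alpha+\beta})$, $|\alpha|,|\beta|\le d$. With $v_\alpha(t,y)=(t,y)^\alpha$ for $\alpha\in\mathbb N^{1+n}$, the infinite-dimensional moment SDP is $$p_\infty^*=\inf_z\ \ell_z(\hat l)\quad\text{s.t.}\quad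 \ell_z\Big(\frac{\partial v_\alpha}{\partial t}\,w_0^p+\frac{\partial v_\alpha}{\partial y}\,\hat f\Big)=v_\alpha(t_f,y_f)-v_\alpha(t_0,y_0)\ \ \forall\alpha\in\mathbb N^{1+n},$$ $$M_d(g_i\,z)\succeq 0,\quad i=0,1,\dots,N,\ d\in\mathbb N.$$ Both values are taken in $[-\infty,+\infty]$, with $\inf\emptyset=+\infty$. Then $$p_W^*=p_\infty^*.$$ -/

import Mathlib

noncomputable section

namespace MomentControl

open MvPolynomial MeasureTheory

/-- Labels of the variables `(t, y₁, …, yₙ)`. -/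
abbrev StateVar (n : ℕ) := Unit ⊕ Fin n

/-- Labels of the variables `(t, y, u₁, …, uₘ)` of the Lagrangian and of the dynamics. -/
abbrev DataVar (n m : ℕ) := StateVar n ⊕ Fin m

/-- Labels of the `1 + n + 1 + m` variables `(t, y, w₀, w₁, …, wₘ)`. -/
abbrev Var (n m : ℕ) := StateVar n ⊕ (Unit ⊕ Fin m)

/-- The space of the points `(t, y, w₀, w)`. -/
abbrev Pt (n m : ℕ) := ℝ × (Fin n → ℝ) × ℝ × (Fin m → ℝ)

/-- The coordinates of `(t, y)`, indexed by `StateVar n`. -/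
def stateCoords {n : ℕ} (t : ℝ) (y : Fin n → ℝ) : StateVar n → ℝ :=
  Sum.elim (fun _ => t) y

/-- The coordinates of `(t, y, w₀, w)`, indexed by `Var n m`. -/
def coords {n m : ℕ} (x : Pt n m) : Var n m → ℝ :=
  Sum.elim (stateCoords x.1 x.2.1) (Sum.elim (fun _ => x.2.2.1) x.2.2.2)

/-- The raw data of a polynomial optimal control problem: the growth exponent `p`, the time
interval `[t₀, t_f]`, the prescribed boundary states, the polynomials `gY` whose common
nonnegativity set is the state constraint set, the Lagrangian `l` and the dynamics `f`. -/
structure ControlData (n m : ℕ) where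
  p : ℕ
  t₀ : ℝ
  t_f : ℝ
  y₀ : Fin n → ℝ
  y_f : Fin n → ℝ
  nY : ℕ
  gY : Fin nY → MvPolynomial (Fin n) ℝ
  l : MvPolynomial (DataVar n m) ℝ
  f : Fin n → MvPolynomial (DataVar n m) ℝ

/-- The degree of a monomial in the `t, y, u` variables with respect to the control `u` only. -/
def controlDegree {n m : ℕ} (s : DataVar n m →₀ ℕ) : ℕ := ∑ j : Fin m, s (Sum.inr j)

/-- Every monomial of `q` has degree at most `p` with respect to the control. -/
def ControlDegreeLE {n m : ℕ} (p : ℕ) (q : MvPolynomial (DataVar n m) ℝ) : Prop :=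
  ∀ s ∈ q.support, controlDegree s ≤ p

/-- Homogenization by `w₀` with respect to the control: in each term of `q`, the control `u` is
replaced by `w` and the term is multiplied by the power of `w₀` that makes its degree in
`(w₀, w)` equal to `p`. -/
def homogenize {n m : ℕ} (p : ℕ) (q : MvPolynomial (DataVar n m) ℝ) : MvPolynomial (Var n m) ℝ :=
  ∑ s ∈ q.support,
    C (q.coeff s) * (∏ i : StateVar n, X (Sum.inl i) ^ s (Sum.inl i)) *
      X (Sum.inr (Sum.inl ())) ^ (p - controlDegree s) *
      ∏ j : Fin m, X (Sum.inr (Sum.inr j)) ^ s (Sum.inr j)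

/-- The compact set `W` of the extended controls `(w₀, w)`: `w₀ ∈ [0, 1]`, `w` lies in the unit
ball of the `p`-norm, and `w₀ ^ p = 1 - ∑ wᵢ ^ p`. -/
def extControlSet (m p : ℕ) : Set (ℝ × (Fin m → ℝ)) :=
  {w | w.1 ∈ Set.Icc (0 : ℝ) 1 ∧ ∑ i, |w.2 i| ^ p ≤ 1 ∧ w.1 ^ p = 1 - ∑ i, w.2 i ^ p}

namespace ControlData

variable {n m : ℕ} (P : ControlData n m)

/-- The state constraint set `Y = {y | gY i (y) ≥ 0 for all i}`. -/
def Y : Set (Fin n → ℝ) := {y | ∀ i, 0 ≤ eval y (P.gY i)}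

/-- The set `G = T × Y × W`, with `T = [t₀, t_f]`. -/
def G : Set (Pt n m) := Set.Icc P.t₀ P.t_f ×ˢ P.Y ×ˢ extControlSet m P.p

/-- The homogenized Lagrangian. -/
def lHat : MvPolynomial (Var n m) ℝ := homogenize P.p P.l

/-- The homogenized dynamics. -/
def fHat (k : Fin n) : MvPolynomial (Var n m) ℝ := homogenize P.p (P.f k)

/-! ### The measure LP -/

/-- The integrand `∂v/∂t · w₀ ^ p + ∂v/∂y · f̂` of the weak dynamics, for a test function `v`. -/
def weakIntegrand (v : ℝ × (Fin n → ℝ) → ℝ) (x : Pt n m) : ℝ :=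
  fderiv ℝ v (x.1, x.2.1) (1, 0) * x.2.2.1 ^ P.p +
    fderiv ℝ v (x.1, x.2.1) (0, fun k => eval (coords x) (P.fHat k))

/-- Feasibility in the measure LP: `μ` is a finite nonnegative Borel measure supported on `G`
that satisfies the weak dynamics for all test functions in `C¹(T × Y)`, i.e. for the (restrictions
to `T × Y` of) continuously differentiable functions. -/
structure IsFeasibleMeasure (μ : Measure (Pt n m)) : Prop where
  finite : IsFiniteMeasure μ
  support : μ P.Gᶜ = 0
  dynamics : ∀ v : ℝ × (Fin n → ℝ) → ℝ, ContDiff ℝ 1 v →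
    ∫ x, P.weakIntegrand v x ∂μ = v (P.t_f, P.y_f) - v (P.t₀, P.y₀)

/-- The value of the measure LP, as an extended real number (`⊤` if it is infeasible). -/
def measureValue : EReal :=
  ⨅ μ : {μ : Measure (Pt n m) // P.IsFeasibleMeasure μ},
    ((∫ x, eval (coords x) P.lHat ∂μ.1 : ℝ) : EReal)

end ControlData

/-! ### The moment problem -/

/-- The linear functional `ℓ_z` on polynomials, `∑ q_β x^β ↦ ∑ q_β z_β`. -/
def riesz {σ : Type*} (z : (σ →₀ ℕ) → ℝ) (q : MvPolynomial σ ℝ) : ℝ :=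
  ∑ β ∈ q.support, q.coeff β * z β

/-- The localizing matrix `M_d(g z)` of order `d`, indexed by the multi-indices of degree at
most `d`. For `g = 1` it is the moment matrix. -/
def localizingMatrix {σ : Type*} (d : ℕ) (g : MvPolynomial σ ℝ) (z : (σ →₀ ℕ) → ℝ) :
    Matrix {α : σ →₀ ℕ // α.degree ≤ d} {α : σ →₀ ℕ // α.degree ≤ d} ℝ :=
  Matrix.of fun α β => riesz z (g * monomial (α.1 + β.1) 1)

namespace ControlData

variable {n m : ℕ} (P : ControlData n m)

/-- The polynomial `∂v/∂t · w₀ ^ p + ∂v/∂y · f̂` for the monomial `v = (t, y)^α`. -/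
def dynamicsPoly (α : StateVar n →₀ ℕ) : MvPolynomial (Var n m) ℝ :=
  rename Sum.inl (pderiv (Sum.inl ()) (monomial α (1 : ℝ))) * X (Sum.inr (Sum.inl ())) ^ P.p +
    ∑ k : Fin n, rename Sum.inl (pderiv (Sum.inr k) (monomial α (1 : ℝ))) * P.fHat k

/-- Feasibility in the moment problem given by the description `g i ≥ 0` of `G`, to which the
trivial inequality `1 ≥ 0` is added. -/
structure IsFeasibleMoments {N : ℕ} (g : Fin N → MvPolynomial (Var n m) ℝ)
    (z : (Var n m →₀ ℕ) → ℝ) : Prop where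
  dynamics : ∀ α : StateVar n →₀ ℕ, riesz z (P.dynamicsPoly α) =
    eval (stateCoords P.t_f P.y_f) (monomial α (1 : ℝ)) -
      eval (stateCoords P.t₀ P.y₀) (monomial α (1 : ℝ))
  moment : ∀ d : ℕ, (localizingMatrix d 1 z).PosSemidef
  localizing : ∀ (d : ℕ) (i : Fin N), (localizingMatrix d (g i) z).PosSemidef

/-- The value of the moment problem, as an extended real number (`⊤` if it is infeasible). -/
def momentValue {N : ℕ} (g : Fin N → MvPolynomial (Var n m) ℝ) : EReal :=
  ⨅ z : {z : (Var n m →₀ ℕ) → ℝ // P.IsFeasibleMoments g z}, ((riesz z.1 P.lHat : ℝ) : EReal)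

end ControlData

end MomentControl

end

/-! The two problems have matching feasible points with equal objective values. A feasible measure
on the compact set `G` yields its moment sequence, whose localizing matrices are positive
semidefinite because each `g i` is nonnegative on `G`. The converse carries the weight and has two
ingredients.

The first is the dual form of Putinar's theorem (`exists_measure_of_posOn`): a functional that is
nonnegative on an Archimedean quadratic module is integration against a measure on its nonnegativity
set. The proof is by Krein–Milman. The normalized functionals form a compact convex set. If `L` is
extreme in it, then `q ↦ L ((r + 1 ± X j) * q)` are, up to scaling, two members of the set whose
convex combination is `L`, so both equal `L`. Hence `L` is multiplicative and is evaluation at a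
point (`riesz_X_mul_of_mem_extremePoints`). The sequences represented by probability measures form a
compact convex set containing these evaluations, hence everything.

The second is approximation in `C¹` (`exists_stateFun_tendsto`): moments only test the dynamics
against polynomials. Convolving a compactly supported `C¹` function with powers of a peaked
polynomial gives polynomials that converge together with their first derivatives, with bounded
derivatives, so dominated convergence gives the dynamics for all `C¹` test functions. -/

namespace MomentControl

open MvPolynomial MeasureTheory

/-! ### Riesz functionals of real sequences. -/

section Riesz

variable {σ : Type*}

/-- The Riesz functional of a sequence, as a linear map. -/
noncomputable def rieszLin (z : (σ →₀ ℕ) → ℝ) : MvPolynomial σ ℝ →ₗ[ℝ] ℝ :=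
  (basisMonomials σ ℝ).constr ℝ z

theorem rieszLin_monomial (z : (σ →₀ ℕ) → ℝ) (s : σ →₀ ℕ) (a : ℝ) :
    rieszLin z (monomial s a) = a * z s := by
  have h : monomial s a = a • (basisMonomials σ ℝ s) := by
    simp [coe_basisMonomials, smul_monomial]
  rw [h, map_smul, rieszLin, Module.Basis.constr_basis, smul_eq_mul]

theorem rieszLin_apply (z : (σ →₀ ℕ) → ℝ) (q : MvPolynomial σ ℝ) :
    rieszLin z q = riesz z q := by
  conv_lhs => rw [← support_sum_monomial_coeff q]
  rw [map_sum]
  exact Finset.sum_congr rfl fun _ _ => rieszLin_monomial _ _ _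

theorem rieszLin_one (z : (σ →₀ ℕ) → ℝ) : rieszLin z 1 = z 0 := by
  have : (1 : MvPolynomial σ ℝ) = monomial 0 1 := rfl
  rw [this, rieszLin_monomial, one_mul]

theorem rieszLin_of_linearMap (L : MvPolynomial σ ℝ →ₗ[ℝ] ℝ) :
    rieszLin (fun s => L (monomial s 1)) = L := by
  refine (basisMonomials σ ℝ).ext fun s => ?_
  simp [coe_basisMonomials, rieszLin_monomial]

theorem continuous_riesz (q : MvPolynomial σ ℝ) :
    Continuous fun z : (σ →₀ ℕ) → ℝ => riesz z q := by
  unfold riesz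
  fun_prop

theorem riesz_add_smul (a b : ℝ) (z w : (σ →₀ ℕ) → ℝ) (q : MvPolynomial σ ℝ) :
    riesz (a • z + b • w) q = a * riesz z q + b * riesz w q := by
  simp only [riesz, Finset.mul_sum, ← Finset.sum_add_distrib, Pi.add_apply, Pi.smul_apply,
    smul_eq_mul]
  exact Finset.sum_congr rfl fun _ _ => by ring

end Riesz

/-! ### Bounds for functionals nonnegative on an Archimedean quadratic module. -/

section Positive

/-- A log-convex nonnegative sequence which grows at most like `r ^ k` grows at most by the factor
`r` in its first step. -/
theorem le_mul_of_logConvex_of_growth {a : ℕ → ℝ} {C r : ℝ} (hr : 0 ≤ r) (ha : ∀ k, 0 ≤ a k)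
    (hlc : ∀ k, a (k + 1) ^ 2 ≤ a k * a (k + 2)) (hg : ∀ k, a k ≤ C * r ^ k) :
    a 1 ≤ r * a 0 := by
  by_contra! h
  have h0 : 0 < a 0 := by
    rcases (ha 0).lt_or_eq with h0 | h0
    · exact h0
    · have := hlc 0
      rw [← h0] at this h
      simp only [zero_add, zero_mul, mul_zero] at this h
      nlinarith
  set ρ := a 1 / a 0 with hρ
  have hrρ : r < ρ := by rwa [hρ, lt_div_iff₀ h0]
  have hρ0 : 0 < ρ := hr.trans_lt hrρ
  -- Log-convexity makes the ratios of consecutive terms nondecreasing, so all are at least `ρ > r`;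
  -- geometric growth at rate `ρ` then contradicts the bound `C * r ^ k`.
  have step : ∀ k, 0 < a k ∧ ρ * a k ≤ a (k + 1) := by
    intro k
    induction k with
    | zero => exact ⟨h0, by rw [hρ]; field_simp; simp⟩
    | succ k ih =>
      obtain ⟨hk, hk1⟩ := ih
      have hpos : 0 < a (k + 1) := (mul_pos hρ0 hk).trans_le hk1
      refine ⟨hpos, ?_⟩
      have := hlc k
      refine le_of_mul_le_mul_left ?_ hk
      nlinarith
  have low : ∀ k, ρ ^ k * a 0 ≤ a k := by
    intro k
    induction k with
    | zero => simp
    | succ k ih =>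
      calc ρ ^ (k + 1) * a 0 = ρ * (ρ ^ k * a 0) := by ring
        _ ≤ ρ * a k := by gcongr
        _ ≤ a (k + 1) := (step k).2
  have hlim : Filter.Tendsto (fun k : ℕ => C * (r / ρ) ^ k) Filter.atTop (nhds (C * 0)) :=
    (tendsto_pow_atTop_nhds_zero_of_lt_one (by positivity)
      ((div_lt_one hρ0).2 hrρ)).const_mul C
  have hle : a 0 ≤ C * 0 := by
    refine ge_of_tendsto' hlim fun k => ?_
    rw [div_pow, ← mul_div_assoc, le_div_iff₀ (by positivity)]
    linarith [low k, hg k]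
  linarith

variable {σ : Type*}

/-- The functional `L` is nonnegative on the quadratic module generated by `S`. -/
def PosOn (S : Set (MvPolynomial σ ℝ)) (L : MvPolynomial σ ℝ →ₗ[ℝ] ℝ) : Prop :=
  ∀ g ∈ S, ∀ q, 0 ≤ L (g * (q * q))

/-- Cauchy–Schwarz, from the discriminant of the nonnegative quadratic `x ↦ L ((x b + a)²)`. -/
theorem sq_le_mul_of_sq_nonneg {L : MvPolynomial σ ℝ →ₗ[ℝ] ℝ} (hL : ∀ q, 0 ≤ L (q * q))
    (a b : MvPolynomial σ ℝ) : L (a * b) ^ 2 ≤ L (a * a) * L (b * b) := by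
  have h : ∀ x : ℝ, 0 ≤ L (b * b) * (x * x) + (2 * L (a * b)) * x + L (a * a) := by
    intro x
    have := hL (x • b + a)
    have e : (x • b + a) * (x • b + a) = (x * x) • (b * b) + (2 * x) • (a * b) + a * a := by
      simp only [smul_eq_C_mul, map_mul, map_ofNat]
      ring
    rw [e] at this
    simp only [map_add, map_smul, smul_eq_mul] at this
    linarith
  have := discrim_le_zero h
  unfold discrim at this
  nlinarith

namespace PosOn

variable {S : Set (MvPolynomial σ ℝ)} {L : MvPolynomial σ ℝ →ₗ[ℝ] ℝ} {r : ℝ}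

theorem sq_nonneg (hL : PosOn S L) (h1 : 1 ∈ S) (q : MvPolynomial σ ℝ) : 0 ≤ L (q * q) := by
  simpa using hL 1 h1 q

variable [Fintype σ]

theorem sum_X_sq_mul_le (hL : PosOn S L) (hr : C r - ∑ v, X v ^ 2 ∈ S) (q : MvPolynomial σ ℝ) :
    ∑ v, L ((X v * q) * (X v * q)) ≤ r * L (q * q) := by
  have := hL _ hr q
  have e : (C r - ∑ v, X v ^ 2) * (q * q) = r • (q * q) - ∑ v, (X v * q) * (X v * q) := by
    rw [sub_mul, Finset.sum_mul, smul_eq_C_mul]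
    congr 1
    exact Finset.sum_congr rfl fun _ _ => by ring
  rw [e, map_sub, map_smul, map_sum, smul_eq_mul] at this
  linarith

theorem X_sq_mul_le (hL : PosOn S L) (h1 : 1 ∈ S) (hr : C r - ∑ v, X v ^ 2 ∈ S) (j : σ)
    (q : MvPolynomial σ ℝ) : L ((X j * q) * (X j * q)) ≤ r * L (q * q) :=
  (Finset.single_le_sum (f := fun v => L ((X v * q) * (X v * q)))
    (fun _ _ => hL.sq_nonneg h1 _) (Finset.mem_univ j)).trans (hL.sum_X_sq_mul_le hr q)

theorem radius_nonneg (hL : PosOn S L) (h1 : 1 ∈ S) (hr : C r - ∑ v, X v ^ 2 ∈ S)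
    (hone : L 1 = 1) : 0 ≤ r := by
  have := hL.sum_X_sq_mul_le hr 1
  have h := Finset.sum_nonneg fun v (_ : v ∈ Finset.univ) => hL.sq_nonneg h1 (X v * 1)
  simp only [mul_one, hone] at this h
  linarith

theorem X_pow_mul_le (hL : PosOn S L) (h1 : 1 ∈ S) (hr : C r - ∑ v, X v ^ 2 ∈ S) (hr0 : 0 ≤ r)
    (j : σ) (q : MvPolynomial σ ℝ) (k : ℕ) :
    L ((X j ^ k * q) * (X j ^ k * q)) ≤ r ^ k * L (q * q) := by
  induction k with
  | zero => simp
  | succ k ih =>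
    have := hL.X_sq_mul_le h1 hr j (X j ^ k * q)
    calc L ((X j ^ (k + 1) * q) * (X j ^ (k + 1) * q))
        = L ((X j * (X j ^ k * q)) * (X j * (X j ^ k * q))) := by congr 1; ring
      _ ≤ r * (r ^ k * L (q * q)) := this.trans (by gcongr)
      _ = _ := by ring

/-- Multiplication by a coordinate is bounded for all the forms `q ↦ L (g q²)`. -/
theorem mul_X_sq_mul_le (hL : PosOn S L) (h1 : 1 ∈ S) (hr : C r - ∑ v, X v ^ 2 ∈ S) (hr0 : 0 ≤ r)
    {g : MvPolynomial σ ℝ} (hg : g ∈ S) (j : σ) (q : MvPolynomial σ ℝ) :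
    L (g * ((X j * q) * (X j * q))) ≤ r * L (g * (q * q)) := by
  -- Positivity on the products `g * (r - ∑ X²)` is not available, since they need not lie in the
  -- module. Instead, Cauchy–Schwarz for `q ↦ L (g q²)` gives log-convexity in `k`, and
  -- Cauchy–Schwarz for `L` separates `g q²` from `X j ^ (2k)`, whose square has `L`-value at most
  -- `r ^ (2k) * L 1`.
  have key := le_mul_of_logConvex_of_growth (r := r)
    (a := fun k => L (g * ((X j ^ k * q) * (X j ^ k * q))))
    (C := √(L ((g * (q * q)) * (g * (q * q))) * L (1 * 1))) hr0 (fun k => hL g hg _) ?_ ?_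
  · simpa using key
  · intro k
    have := sq_le_mul_of_sq_nonneg (L := L ∘ₗ LinearMap.mulLeft ℝ g) (fun q => hL g hg q)
      (X j ^ k * q) (X j ^ (k + 2) * q)
    simp only [LinearMap.comp_apply, LinearMap.mulLeft_apply] at this
    convert this using 4
    ring
  · intro k
    have cs := sq_le_mul_of_sq_nonneg (hL.sq_nonneg h1) (g * (q * q)) (X j ^ (k + k) * 1)
    have hb := hL.X_pow_mul_le h1 hr hr0 j 1 (k + k)
    have e : g * (X j ^ k * q * (X j ^ k * q)) = g * (q * q) * (X j ^ (k + k) * 1) := by ring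
    have hA := hL.sq_nonneg h1 (g * (q * q))
    have hB := hL.sq_nonneg h1 1
    rw [e]
    refine le_of_sq_le_sq ?_ (by positivity)
    rw [mul_pow, Real.sq_sqrt (mul_nonneg hA hB)]
    calc _ ≤ _ := cs
      _ ≤ L (g * (q * q) * (g * (q * q))) * (r ^ (k + k) * L (1 * 1)) := by gcongr
      _ = _ := by ring

/-- Expand `L (g (1 + ε X j)² q²) ≥ 0` and bound the term in `(X j)²` by `r`. Consequently,
weighting `L` by `r + 1 ± X j` preserves positivity on the module and gives `1` a positive value:
this is how an extreme functional gets split. -/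
theorem add_smul_X_mul (hL : PosOn S L) (h1 : 1 ∈ S) (hr : C r - ∑ v, X v ^ 2 ∈ S) (hr0 : 0 ≤ r)
    {ε : ℝ} (hε : ε ^ 2 = 1) {g : MvPolynomial σ ℝ} (hg : g ∈ S) (j : σ) (q : MvPolynomial σ ℝ) :
    (r + 1) / 2 * L (g * (q * q)) ≤ L ((C (r + 1) + C ε * X j) * (g * (q * q))) := by
  have h2 := hL.mul_X_sq_mul_le h1 hr hr0 hg j q
  have h3 := hL g hg (q + ε • (X j * q))
  have e1 : g * ((q + ε • (X j * q)) * (q + ε • (X j * q))) =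
      g * (q * q) + (2 * ε) • (X j * (g * (q * q))) + (ε ^ 2) • (g * ((X j * q) * (X j * q))) := by
    simp only [smul_eq_C_mul, map_mul, map_ofNat, map_pow]
    ring
  have e2 : (C (r + 1) + C ε * X j) * (g * (q * q)) =
      (r + 1) • (g * (q * q)) + ε • (X j * (g * (q * q))) := by
    simp only [smul_eq_C_mul]
    ring
  rw [e1] at h3
  rw [e2]
  simp only [map_add, map_smul, smul_eq_mul, hε] at h3 ⊢
  linarith

theorem monomial_sq_le (hL : PosOn S L) (h1 : 1 ∈ S) (hr : C r - ∑ v, X v ^ 2 ∈ S) (hr0 : 0 ≤ r)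
    (s : σ →₀ ℕ) (q : MvPolynomial σ ℝ) :
    L ((monomial s (1 : ℝ) * q) * (monomial s (1 : ℝ) * q)) ≤ r ^ s.degree * L (q * q) := by
  induction s using Finsupp.induction_linear generalizing q with
  | zero => rw [map_zero, pow_zero, one_mul, ← one_def, one_mul]
  | add s t hs ht =>
    have e : (monomial (s + t) (1 : ℝ)) * q = monomial s 1 * (monomial t 1 * q) := by
      rw [← mul_assoc, monomial_mul, one_mul]
    have hd : r ^ (s + t).degree = r ^ s.degree * r ^ t.degree := by rw [map_add, pow_add]
    rw [e, hd, mul_assoc (r ^ s.degree)]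
    have h2 := mul_le_mul_of_nonneg_left (ht q) (pow_nonneg hr0 s.degree)
    exact le_trans (hs _) h2
  | single j k =>
    rw [← X_pow_eq_monomial, Finsupp.degree_single]
    exact hL.X_pow_mul_le h1 hr hr0 j q k

/-- Cauchy–Schwarz against `1` gives `L(x^s)² ≤ r ^ s.degree`, and `|x| ≤ x² + 1` avoids the square
root. -/
theorem abs_apply_monomial_le (hL : PosOn S L) (h1 : 1 ∈ S) (hr : C r - ∑ v, X v ^ 2 ∈ S)
    (hone : L 1 = 1) (s : σ →₀ ℕ) : |L (monomial s 1)| ≤ r ^ s.degree + 1 := by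
  have hr0 := hL.radius_nonneg h1 hr hone
  have h := sq_le_mul_of_sq_nonneg (hL.sq_nonneg h1) (monomial s 1 * 1) 1
  have h' := hL.monomial_sq_le h1 hr hr0 s 1
  simp only [mul_one, hone] at h h'
  rw [abs_le]
  constructor <;> nlinarith

end PosOn

end Positive

/-! ### Representing measures by Krein–Milman. -/

section RepresentingMeasure

variable {σ : Type*}

/-- The normalized sequences whose Riesz functional is nonnegative on the quadratic module
generated by `S`. -/
def normalizedMoments (S : Set (MvPolynomial σ ℝ)) : Set ((σ →₀ ℕ) → ℝ) :=
  {z | z 0 = 1 ∧ PosOn S (rieszLin z)}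

/-- The moment sequence of a point. -/
noncomputable def pointMoments (a : σ → ℝ) : (σ →₀ ℕ) → ℝ := fun s => eval a (monomial s 1)

/-- The points at which all polynomials of `S` are nonnegative. -/
def nonnegSet (S : Set (MvPolynomial σ ℝ)) : Set (σ → ℝ) := {a | ∀ g ∈ S, 0 ≤ eval a g}

variable {S : Set (MvPolynomial σ ℝ)}

theorem convex_normalizedMoments : Convex ℝ (normalizedMoments S) := by
  intro z hz w hw a b ha hb hab
  refine ⟨by simp [hz.1, hw.1, hab], fun g hg q => ?_⟩
  have h1 := hz.2 g hg q
  have h2 := hw.2 g hg q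
  rw [rieszLin_apply] at h1 h2 ⊢
  rw [riesz_add_smul]
  positivity

theorem isClosed_normalizedMoments : IsClosed (normalizedMoments S) := by
  have : normalizedMoments S = {z | z 0 = 1} ∩ ⋂ g ∈ S, ⋂ q, {z | 0 ≤ riesz z (g * (q * q))} := by
    ext z
    simp [normalizedMoments, PosOn, rieszLin_apply]
  rw [this]
  refine (isClosed_eq (continuous_apply 0) continuous_const).inter ?_
  exact isClosed_biInter fun g _ => isClosed_iInter fun q =>
    isClosed_le continuous_const (continuous_riesz _)

variable [Fintype σ] {r : ℝ}

/-- Tychonoff: the set is closed in the product topology, and each moment is confined to an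
interval. -/
theorem isCompact_normalizedMoments (h1 : 1 ∈ S) (hr : C r - ∑ v, X v ^ 2 ∈ S) :
    IsCompact (normalizedMoments S) := by
  refine (isCompact_univ_pi fun s : σ →₀ ℕ =>
    isCompact_Icc (a := -(r ^ s.degree + 1)) (b := r ^ s.degree + 1)).of_isClosed_subset
      isClosed_normalizedMoments fun z hz s _ => ?_
  have h := hz.2.abs_apply_monomial_le h1 hr (by rw [rieszLin_one, hz.1]) s
  rw [rieszLin_monomial, one_mul] at h
  exact abs_le.1 h

/-- The functional of an extreme point commutes with the multiplication by a coordinate. -/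
theorem riesz_X_mul_of_mem_extremePoints (h1 : 1 ∈ S) (hr : C r - ∑ v, X v ^ 2 ∈ S)
    {z : (σ →₀ ℕ) → ℝ} (hz : z ∈ (normalizedMoments S).extremePoints ℝ) (j : σ)
    (q : MvPolynomial σ ℝ) :
    rieszLin z (X j * q) = rieszLin z (X j) * rieszLin z q := by
  obtain ⟨⟨hz0, hL⟩, hext⟩ := hz
  set L := rieszLin z with hLdef
  have hone : L 1 = 1 := by rw [hLdef, rieszLin_one, hz0]
  have hr0 := hL.radius_nonneg h1 hr hone
  let h : ℝ → MvPolynomial σ ℝ := fun ε => C (r + 1) + C ε * X j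
  have hpos : ∀ ε : ℝ, ε ^ 2 = 1 → 0 < L (h ε) := by
    intro ε hε
    have := hL.add_smul_X_mul h1 hr hr0 hε h1 j 1
    simp only [mul_one, hone] at this
    exact lt_of_lt_of_le (by positivity) this
  let w : ℝ → (σ →₀ ℕ) → ℝ := fun ε s => (L (h ε))⁻¹ * L (h ε * monomial s 1)
  have hw : ∀ ε q, rieszLin (w ε) q = (L (h ε))⁻¹ * L (h ε * q) := by
    intro ε q
    have := rieszLin_of_linearMap ((L (h ε))⁻¹ • (L ∘ₗ LinearMap.mulLeft ℝ (h ε)))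
    exact congrArg (fun L => L q) this
  have hmem : ∀ ε : ℝ, ε ^ 2 = 1 → w ε ∈ normalizedMoments S := by
    intro ε hε
    refine ⟨?_, fun g hg q => ?_⟩
    · rw [← rieszLin_one (w ε), hw, mul_one, inv_mul_cancel₀ (hpos ε hε).ne']
    · rw [hw]
      have h2 := hL.add_smul_X_mul h1 hr hr0 hε hg j q
      have h3 := hL g hg q
      exact mul_nonneg (inv_nonneg.2 (hpos ε hε).le) (le_trans (by positivity) h2)
  have hp := hpos 1 (by norm_num)
  have hm := hpos (-1) (by norm_num)
  have hsum : ∀ q, L (h 1 * q) + L (h (-1) * q) = 2 * (r + 1) * L q := by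
    intro q
    rw [← map_add]
    have : h 1 * q + h (-1) * q = (2 * (r + 1)) • q := by
      simp only [h, smul_eq_C_mul, map_neg, map_mul, map_ofNat, map_one]
      ring
    rw [this, map_smul, smul_eq_mul]
  have hsum1 : L (h 1) + L (h (-1)) = 2 * (r + 1) := by
    have := hsum 1
    simpa [hone] using this
  -- The weights `r + 1 + X j` and `r + 1 - X j` add up to the constant `2 (r + 1)`.
  have hseg : z ∈ openSegment ℝ (w 1) (w (-1)) := by
    refine ⟨L (h 1) / (2 * (r + 1)), L (h (-1)) / (2 * (r + 1)), by positivity, by positivity,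
      by rw [← add_div, hsum1, div_self (by positivity)], ?_⟩
    funext s
    have hs := hsum (monomial s 1)
    have hz : L (monomial s 1) = z s := by rw [hLdef, rieszLin_monomial, one_mul]
    rw [hz] at hs
    simp only [Pi.add_apply, Pi.smul_apply, smul_eq_mul, w]
    field_simp
    linarith
  have heq := hext (hmem 1 (by norm_num)) (hmem (-1) (by norm_num)) hseg
  -- Extremality gives `L (h 1 * q) = L (h 1) * L q`; cancelling the constant `r + 1` leaves
  -- multiplicativity in `X j`.
  have hq : L q = (L (h 1))⁻¹ * L (h 1 * q) := by rw [← hw, heq]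
  have e1 : h 1 * q = (r + 1) • q + X j * q := by
    simp only [h, smul_eq_C_mul, map_one]
    ring
  have e2 : h 1 = (r + 1) • 1 + X j := by
    simp only [h, smul_eq_C_mul, map_one]
    ring
  have e3 : L (h 1 * q) = (r + 1) * L q + L (X j * q) := by
    rw [e1, map_add, map_smul, smul_eq_mul]
  have e4 : L (h 1) = (r + 1) + L (X j) := by
    rw [e2, map_add, map_smul, smul_eq_mul, hone, mul_one]
  field_simp at hq
  rw [e3, e4] at hq
  linarith

/-- The point has coordinates `L (X j)`: multiplicativity in the coordinates propagates to all
polynomials, and positivity on `g * 1²` puts the point in the nonnegativity set. -/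
theorem exists_eq_pointMoments_of_mem_extremePoints (h1 : 1 ∈ S) (hr : C r - ∑ v, X v ^ 2 ∈ S)
    {z : (σ →₀ ℕ) → ℝ} (hz : z ∈ (normalizedMoments S).extremePoints ℝ) :
    ∃ a : σ → ℝ, (∀ g ∈ S, 0 ≤ eval a g) ∧ z = pointMoments a := by
  have hone : rieszLin z 1 = 1 := by rw [rieszLin_one, hz.1.1]
  have hmul := riesz_X_mul_of_mem_extremePoints h1 hr hz
  have hev : ∀ q, rieszLin z q = eval (fun j => rieszLin z (X j)) q := by
    intro q
    induction q using MvPolynomial.induction_on with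
    | C a =>
      have : (C a : MvPolynomial σ ℝ) = a • 1 := by rw [smul_eq_C_mul, mul_one]
      rw [eval_C, this, map_smul, hone, smul_eq_mul, mul_one]
    | add p q hp hq => rw [map_add, hp, hq, map_add]
    | mul_X p j hp => rw [mul_comm, hmul, hp, map_mul, eval_X]
  refine ⟨fun j => rieszLin z (X j), fun g hg => ?_, funext fun s => ?_⟩
  · have := hz.1.2 g hg 1
    rwa [mul_one, mul_one, hev] at this
  · rw [pointMoments, ← hev, rieszLin_monomial, one_mul]

theorem isCompact_nonnegSet (hr : C r - ∑ v, X v ^ 2 ∈ S) :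
    IsCompact (nonnegSet S) := by
  have hcl : IsClosed (nonnegSet S) := by
    have : nonnegSet S = ⋂ g ∈ S, {a | 0 ≤ eval a g} := by
      ext a
      simp [nonnegSet]
    rw [this]
    exact isClosed_biInter fun g _ => isClosed_le continuous_const (continuous_eval g)
  refine (isCompact_univ_pi fun _ : σ =>
    isCompact_Icc (a := -(r + 1)) (b := r + 1)).of_isClosed_subset hcl fun a ha v _ => ?_
  have h := ha _ hr
  simp only [map_sub, eval_C, map_sum, map_pow, eval_X] at h
  have h2 := Finset.single_le_sum (f := fun v => a v ^ 2) (fun _ _ => sq_nonneg _)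
    (Finset.mem_univ v)
  have h3 : a v ^ 2 ≤ r := by linarith
  constructor <;> nlinarith

/-- Normalized moment sequences that are nonnegative on an Archimedean quadratic module have a
representing probability measure. -/
theorem exists_probabilityMeasure_of_mem_normalizedMoments (h1 : 1 ∈ S)
    (hr : C r - ∑ v, X v ^ 2 ∈ S) {z : (σ →₀ ℕ) → ℝ} (hz : z ∈ normalizedMoments S) :
    ∃ μ : ProbabilityMeasure (nonnegSet S),
      ∀ s, z s = ∫ a : nonnegSet S, eval a.1 (monomial s 1) ∂(μ : Measure (nonnegSet S)) := by
  let A := nonnegSet S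
  have hAc : IsCompact A := isCompact_nonnegSet hr
  have : CompactSpace A := isCompact_iff_compactSpace.1 hAc
  have hcont : ∀ s : σ →₀ ℕ, Continuous fun a : A => eval a.1 (monomial s (1 : ℝ)) :=
    fun s => (continuous_eval _).comp continuous_subtype_val
  let Φ : ProbabilityMeasure A → (σ →₀ ℕ) → ℝ :=
    fun μ s => ∫ a : A, eval a.1 (monomial s 1) ∂(μ : Measure A)
  have hΦ : Continuous Φ := by
    refine continuous_pi fun s => ?_
    refine continuous_iff_continuousAt.2 fun μ => ?_
    exact (ProbabilityMeasure.tendsto_iff_forall_integral_tendsto.1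
      (Filter.tendsto_id (x := nhds μ))) (BoundedContinuousFunction.mkOfCompact ⟨_, hcont s⟩)
  have hint : ∀ (μ : ProbabilityMeasure A) (s : σ →₀ ℕ),
      Integrable (fun a : A => eval a.1 (monomial s (1 : ℝ))) (μ : Measure A) := fun μ s =>
    (BoundedContinuousFunction.mkOfCompact ⟨_, hcont s⟩).integrable _
  have hconv : Convex ℝ (Set.range Φ) := by
    rintro _ ⟨μ, rfl⟩ _ ⟨ν, rfl⟩ a b ha hb hab
    have hprob : IsProbabilityMeasure
        (ENNReal.ofReal a • (μ : Measure A) + ENNReal.ofReal b • (ν : Measure A)) := by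
      constructor
      simp [← ENNReal.ofReal_add ha hb, hab]
    refine ⟨⟨_, hprob⟩, funext fun s => ?_⟩
    change ∫ x : A, eval x.1 (monomial s 1) ∂(ENNReal.ofReal a • (μ : Measure A) +
      ENNReal.ofReal b • (ν : Measure A)) = _
    rw [integral_add_measure ((hint μ s).smul_measure ENNReal.ofReal_ne_top)
      ((hint ν s).smul_measure ENNReal.ofReal_ne_top), integral_smul_measure,
      integral_smul_measure, ENNReal.toReal_ofReal ha, ENNReal.toReal_ofReal hb]
    rfl
  -- Krein–Milman: the range is convex and compact, as a continuous image of the probability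
  -- measures on a compact space, and Dirac measures represent the extreme points.
  have hsub : normalizedMoments S ⊆ Set.range Φ := by
    rw [← closure_convexHull_extremePoints (isCompact_normalizedMoments h1 hr)
      convex_normalizedMoments]
    refine closure_minimal (convexHull_min ?_ hconv) (isCompact_range hΦ).isClosed
    intro w hw
    obtain ⟨a, ha, rfl⟩ := exists_eq_pointMoments_of_mem_extremePoints h1 hr hw
    refine ⟨⟨Measure.dirac ⟨a, ha⟩, inferInstance⟩, funext fun s => ?_⟩
    exact integral_dirac _ _
  obtain ⟨μ, hμ⟩ := hsub hz
  exact ⟨μ, fun s => (congrFun hμ s).symm⟩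

/-- A sequence whose Riesz functional is nonnegative on an Archimedean quadratic module has a
representing measure. -/
theorem exists_measure_of_posOn (h1 : 1 ∈ S) (hr : C r - ∑ v, X v ^ 2 ∈ S) {z : (σ →₀ ℕ) → ℝ}
    (hz : PosOn S (rieszLin z)) :
    ∃ μ : Measure (σ → ℝ), IsFiniteMeasure μ ∧ μ (nonnegSet S)ᶜ = 0 ∧
      ∀ q, riesz z q = ∫ a, eval a q ∂μ := by
  have hAc : IsCompact (nonnegSet S) := isCompact_nonnegSet hr
  have hz0 : 0 ≤ z 0 := by
    have := hz.sq_nonneg h1 1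
    rwa [mul_one, rieszLin_one] at this
  rcases hz0.eq_or_lt with h0 | h0
  -- With zero mass, Cauchy–Schwarz against `1` makes the whole functional vanish.
  · refine ⟨0, inferInstance, by simp, fun q => ?_⟩
    have := sq_le_mul_of_sq_nonneg (hz.sq_nonneg h1) q 1
    rw [mul_one, mul_one, rieszLin_one, ← h0, mul_zero] at this
    rw [← rieszLin_apply, integral_zero_measure]
    exact pow_eq_zero_iff two_ne_zero |>.1 (le_antisymm this (sq_nonneg _))
  · have hlin : ∀ q, rieszLin ((z 0)⁻¹ • z) q = (z 0)⁻¹ * rieszLin z q := by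
      intro q
      have := riesz_add_smul (z 0)⁻¹ 0 z 0 q
      simpa [rieszLin_apply] using this
    obtain ⟨μ, hμ⟩ := exists_probabilityMeasure_of_mem_normalizedMoments h1 hr
      (z := (z 0)⁻¹ • z) ⟨by simp [h0.ne'], fun g hg q => by
        rw [hlin]; exact mul_nonneg (inv_nonneg.2 h0.le) (hz g hg q)⟩
    have hemb := MeasurableEmbedding.subtype_coe hAc.isClosed.measurableSet
    have : CompactSpace (nonnegSet S) := isCompact_iff_compactSpace.1 hAc
    have hint : ∀ s : σ →₀ ℕ, Integrable
        (fun a : nonnegSet S => eval a.1 (monomial s (1 : ℝ)))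
        (μ : Measure (nonnegSet S)) := fun s =>
      (BoundedContinuousFunction.mkOfCompact
        ⟨_, (continuous_eval (monomial s (1 : ℝ))).comp continuous_subtype_val⟩).integrable _
    refine ⟨ENNReal.ofReal (z 0) • (μ : Measure (nonnegSet S)).map Subtype.val, ?_, ?_, fun q => ?_⟩
    · have : IsFiniteMeasure ((μ : Measure (nonnegSet S)).map Subtype.val) := inferInstance
      exact Measure.smul_finite _ ENNReal.ofReal_ne_top
    · simp [hemb.map_apply]
    · rw [integral_smul_measure, hemb.integral_map, ENNReal.toReal_ofReal h0.le]
      have e : ∀ a : nonnegSet S, eval a.1 q =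
          ∑ s ∈ q.support, q.coeff s * eval a.1 (monomial s 1) := by
        intro a
        rw [eval_eq]
        simp [eval_monomial, Finsupp.prod]
      simp only [e]
      rw [integral_finsetSum _ fun s _ => (hint s).const_mul _, riesz, smul_eq_mul, Finset.mul_sum]
      refine Finset.sum_congr rfl fun s _ => ?_
      rw [integral_const_mul, ← hμ s, Pi.smul_apply, smul_eq_mul]
      field_simp

end RepresentingMeasure

/-! ### Convolution with powers of a peaked kernel. -/

section Peak

open Filter Topology Metric ContinuousLinearMap
open scoped Convolution

variable {E : Type*} [NormedAddCommGroup E] [MeasurableSpace E] {μ : Measure E}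

theorem convolution_lsmul_eq_setIntegral {a w : E → ℝ} {s : Set E} {x : E}
    (hx : ∀ t, w (x - t) ≠ 0 → t ∈ s) :
    (a ⋆[lsmul ℝ ℝ, μ] w) x = ∫ t in s, a t • w (x - t) ∂μ := by
  rw [convolution_def]
  refine (setIntegral_eq_integral_of_forall_compl_eq_zero fun t ht => ?_).symm
  have : w (x - t) = 0 := by
    by_contra h
    exact ht (hx t h)
  simp [this]

variable [NormedSpace ℝ E] [FiniteDimensional ℝ E] [BorelSpace E] [μ.IsAddHaarMeasure]

variable {c : E → ℝ} {ρ : ℝ}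

/-- The normalized powers of `c` concentrate at its strict maximum `0`. Condition `hx` makes the
values of `c` outside the ball irrelevant, so `c` may be a polynomial. -/
theorem tendsto_inv_integral_mul_convolution (hρ : 0 < ρ) (hc : Continuous c)
    (hlt : ∀ y ∈ closedBall (0 : E) ρ, y ≠ 0 → c y < c 0) (hnn : ∀ y ∈ closedBall (0 : E) ρ, 0 ≤ c y)
    (hc0 : 0 < c 0) {w : E → ℝ} (hw : Continuous w) {x : E}
    (hx : ∀ t, w (x - t) ≠ 0 → t ∈ closedBall (0 : E) ρ) :
    Tendsto (fun k : ℕ => (∫ t in closedBall (0 : E) ρ, c t ^ k ∂μ)⁻¹ *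
      ((fun t => c t ^ k) ⋆[lsmul ℝ ℝ, μ] w) x) atTop (𝓝 (w x)) := by
  have hcomp : IsCompact (closedBall (0 : E) ρ) := isCompact_closedBall 0 ρ
  have h := tendsto_setIntegral_pow_smul_of_unique_maximum_of_isCompact_of_continuousOn (μ := μ)
    hcomp hc.continuousOn hlt hnn hc0
    (subset_closure (ball_subset_interior_closedBall (mem_ball_self hρ)))
    (g := fun t => w (x - t)) (by fun_prop)
  rw [sub_zero] at h
  refine h.congr fun k => ?_
  rw [convolution_lsmul_eq_setIntegral hx, smul_eq_mul]

theorem abs_inv_integral_mul_convolution_le (hc : Continuous c)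
    (hnn : ∀ y ∈ closedBall (0 : E) ρ, 0 ≤ c y) {w : E → ℝ} {M : ℝ} (hM : ∀ y, |w y| ≤ M) {x : E}
    (hx : ∀ t, w (x - t) ≠ 0 → t ∈ closedBall (0 : E) ρ) (k : ℕ) :
    |(∫ t in closedBall (0 : E) ρ, c t ^ k ∂μ)⁻¹ *
      ((fun t => c t ^ k) ⋆[lsmul ℝ ℝ, μ] w) x| ≤ M := by
  have hM0 : 0 ≤ M := (abs_nonneg _).trans (hM 0)
  have hcomp : IsCompact (closedBall (0 : E) ρ) := isCompact_closedBall 0 ρ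
  have hI : 0 ≤ ∫ t in closedBall (0 : E) ρ, c t ^ k ∂μ :=
    setIntegral_nonneg measurableSet_closedBall fun t ht => pow_nonneg (hnn t ht) k
  have hint : IntegrableOn (fun t => c t ^ k * M) (closedBall (0 : E) ρ) μ :=
    ((hc.pow k).mul continuous_const).continuousOn.integrableOn_compact hcomp
  have hle : |((fun t => c t ^ k) ⋆[lsmul ℝ ℝ, μ] w) x| ≤
      (∫ t in closedBall (0 : E) ρ, c t ^ k ∂μ) * M := by
    rw [convolution_lsmul_eq_setIntegral hx, ← integral_mul_const, ← Real.norm_eq_abs]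
    refine norm_integral_le_of_norm_le hint ?_
    refine (ae_restrict_mem measurableSet_closedBall).mono fun t ht => ?_
    rw [norm_smul, Real.norm_of_nonneg (pow_nonneg (hnn t ht) k)]
    exact mul_le_mul_of_nonneg_left (hM _) (pow_nonneg (hnn t ht) k)
  rw [abs_mul, abs_inv, abs_of_nonneg hI]
  -- If the normalizing integral is zero, its inverse is `0` by convention and the bound is trivial.
  rcases hI.eq_or_lt with h0 | h0
  · rw [← h0]
    simpa using hM0
  · rw [inv_mul_le_iff₀ h0]
    exact hle

/-- The derivative falls on `v`, so the same kernel approximates the function and its derivative at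
once. -/
theorem fderiv_convolution_apply {a v : E → ℝ} (ha : Continuous a) (hv : ContDiff ℝ 1 v)
    (hvc : HasCompactSupport v) (x e : E) :
    HasFDerivAt (a ⋆[lsmul ℝ ℝ, μ] v) (fderiv ℝ (a ⋆[lsmul ℝ ℝ, μ] v) x) x ∧
    fderiv ℝ (a ⋆[lsmul ℝ ℝ, μ] v) x e = (a ⋆[lsmul ℝ ℝ, μ] fun y => fderiv ℝ v y e) x := by
  have h := hvc.hasFDerivAt_convolution_right (lsmul ℝ ℝ) (μ := μ) ha.locallyIntegrable hv x
  refine ⟨h.differentiableAt.hasFDerivAt, ?_⟩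
  rw [h.fderiv, convolution_precompR_apply _ ha.locallyIntegrable (hvc.fderiv ℝ)
    (hv.continuous_fderiv one_ne_zero)]

end Peak

/-! ### Polynomial approximation in `C¹`. -/

section PolynomialApproximation

open Filter Topology Metric ContinuousLinearMap
open scoped Convolution Pointwise

/-- The polynomial in `x` with coefficients that are polynomials in `t` whose value is
`q (x - t)`. -/
noncomputable def shiftPoly {σ : Type*} (q : MvPolynomial σ ℝ) : MvPolynomial σ (MvPolynomial σ ℝ) :=
  eval₂Hom (C.comp C) (fun i => X i - C (X i)) q

theorem eval_map_shiftPoly {σ : Type*} (q : MvPolynomial σ ℝ) (x t : σ → ℝ) :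
    eval x (map (eval t) (shiftPoly q)) = eval (x - t) q := by
  induction q using MvPolynomial.induction_on with
  | C a => simp [shiftPoly]
  | add p q hp hq =>
    simp only [shiftPoly, map_add] at hp hq ⊢
    rw [hp, hq]
  | mul_X p j hp =>
    simp only [shiftPoly, map_mul] at hp ⊢
    rw [hp]
    simp

variable {n : ℕ}

instance : (volume : Measure (ℝ × (Fin n → ℝ))).IsAddHaarMeasure :=
  inferInstanceAs ((volume : Measure ℝ).prod (volume : Measure (Fin n → ℝ))).IsAddHaarMeasure

/-- The function on the `(t, y)`-space defined by a polynomial. -/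
noncomputable def stateFun (q : MvPolynomial (StateVar n) ℝ) (x : ℝ × (Fin n → ℝ)) : ℝ :=
  eval (stateCoords x.1 x.2) q

theorem contDiff_stateFun (q : MvPolynomial (StateVar n) ℝ) {k : WithTop ℕ∞} :
    ContDiff ℝ k (stateFun q) := by
  induction q using MvPolynomial.induction_on with
  | C a => 
    have : stateFun (C a : MvPolynomial (StateVar n) ℝ) = fun _ => a := by
      funext x; simp [stateFun]
    rw [this]
    exact contDiff_const
  | add p q hp hq =>
    have : stateFun (p + q) = fun x => stateFun p x + stateFun q x := by
      funext x; simp [stateFun]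
    rw [this]
    exact hp.add hq
  | mul_X p j hp =>
    have : stateFun (p * X j) = fun x => stateFun p x * stateCoords x.1 x.2 j := by
      funext x; simp [stateFun]
    rw [this]
    refine hp.mul ?_
    rcases j with j | j
    · simp only [stateCoords, Sum.elim_inl]
      fun_prop
    · simp only [stateCoords, Sum.elim_inr]
      fun_prop

/-- Expand `q (x - t)` in powers of `x`; integrating its coefficients, polynomials in `t`, against
`v` gives the coefficients of `Q`. -/
theorem exists_stateFun_eq_convolution (q : MvPolynomial (StateVar n) ℝ)
    {v : ℝ × (Fin n → ℝ) → ℝ} (hv : Continuous v) (hvc : HasCompactSupport v) :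
    ∃ Q : MvPolynomial (StateVar n) ℝ, stateFun Q = (stateFun q ⋆[lsmul ℝ ℝ, volume] v) := by
  refine ⟨∑ s ∈ (shiftPoly q).support,
    monomial s (∫ t, stateFun ((shiftPoly q).coeff s) t * v t), funext fun x => ?_⟩
  have hint : ∀ s, Integrable fun t => stateFun ((shiftPoly q).coeff s) t * v t := fun s =>
    ((contDiff_stateFun (k := 0) _).continuous.mul hv).integrable_of_hasCompactSupport
      hvc.mul_left
  rw [convolution_eq_swap]
  have e : ∀ t, (lsmul ℝ ℝ) (stateFun q (x - t)) (v t) =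
      ∑ s ∈ (shiftPoly q).support, (∏ i ∈ s.support, stateCoords x.1 x.2 i ^ s i) *
        (stateFun ((shiftPoly q).coeff s) t * v t) := by
    intro t
    have h1 : stateCoords (x - t).1 (x - t).2 = stateCoords x.1 x.2 - stateCoords t.1 t.2 := by
      funext j
      rcases j with j | j <;> simp [stateCoords]
    rw [lsmul_apply, smul_eq_mul, stateFun, h1, ← eval_map_shiftPoly, eval_map, eval₂_eq,
      Finset.sum_mul]
    exact Finset.sum_congr rfl fun s _ => by rw [stateFun]; ring
  simp only [e]
  rw [integral_finsetSum _ fun s _ => (hint s).const_mul _, stateFun, map_sum]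
  refine Finset.sum_congr rfl fun s _ => ?_
  rw [integral_const_mul, eval_monomial, Finsupp.prod, mul_comm]

/-- A polynomial with a strict maximum at the origin of a ball on which it is nonnegative. -/
theorem exists_peakPoly (n : ℕ) {ρ : ℝ} (hρ : 0 < ρ) : ∃ q : MvPolynomial (StateVar n) ℝ,
    (∀ x ∈ closedBall (0 : ℝ × (Fin n → ℝ)) ρ, x ≠ 0 → stateFun q x < stateFun q 0) ∧
    (∀ x ∈ closedBall (0 : ℝ × (Fin n → ℝ)) ρ, 0 ≤ stateFun q x) ∧ 0 < stateFun q 0 := by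
  have key : ∀ x : ℝ × (Fin n → ℝ), stateFun (C ((1 + n) * ρ ^ 2) - ∑ i, X i ^ 2) x =
      (1 + n) * ρ ^ 2 - (x.1 ^ 2 + ∑ i, x.2 i ^ 2) := by
    intro x
    simp [stateFun, stateCoords]
  have h0 : stateFun (C ((1 + n) * ρ ^ 2) - ∑ i, X i ^ 2) (0 : ℝ × (Fin n → ℝ)) =
      (1 + n) * ρ ^ 2 := by rw [key]; simp
  -- The norm is the sup norm, so on the ball each of the `1 + n` squared coordinates is at most `ρ
  -- ^ 2`.
  refine ⟨C ((1 + n) * ρ ^ 2) - ∑ i, X i ^ 2, fun x _ hx => ?_, fun x hx => ?_, ?_⟩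
  · rw [h0, key]
    have : 0 < x.1 ^ 2 + ∑ i, x.2 i ^ 2 := by
      have hs : ∀ i ∈ Finset.univ, 0 ≤ x.2 i ^ 2 := fun i _ => sq_nonneg _
      rcases (add_nonneg (sq_nonneg x.1) (Finset.sum_nonneg hs)).lt_or_eq with h | h
      · exact h
      · exfalso
        have h2 := (add_eq_zero_iff_of_nonneg (sq_nonneg x.1) (Finset.sum_nonneg hs)).1 h.symm
        refine hx (Prod.ext (by simpa using h2.1) (funext fun i => ?_))
        simpa using (Finset.sum_eq_zero_iff_of_nonneg hs).1 h2.2 i (Finset.mem_univ i)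
    linarith
  · rw [key]
    rw [mem_closedBall_zero_iff] at hx
    have h1 : x.1 ^ 2 ≤ ρ ^ 2 := sq_le_sq.2 (by
      rw [abs_of_pos hρ]; exact (norm_fst_le x).trans hx)
    have h2 : ∑ i, x.2 i ^ 2 ≤ ∑ _i : Fin n, ρ ^ 2 := Finset.sum_le_sum fun i _ => sq_le_sq.2 (by
      rw [abs_of_pos hρ]; exact (norm_le_pi_norm x.2 i).trans ((norm_snd_le x).trans hx))
    simp at h2
    linarith
  · rw [h0]
    positivity

/-- Polynomial approximation of a `C¹` function with compact support and of its derivative,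
boundedly and pointwise on a bounded set. -/
theorem exists_stateFun_tendsto_of_hasCompactSupport {v : ℝ × (Fin n → ℝ) → ℝ}
    (hv : ContDiff ℝ 1 v) (hvc : HasCompactSupport v) {K : Set (ℝ × (Fin n → ℝ))}
    (hK : IsCompact K) :
    ∃ (Q : ℕ → MvPolynomial (StateVar n) ℝ) (M : ℝ), ∀ x ∈ K,
      Tendsto (fun k => stateFun (Q k) x) atTop (𝓝 (v x)) ∧
      ∀ e, Tendsto (fun k => fderiv ℝ (stateFun (Q k)) x e) atTop (𝓝 (fderiv ℝ v x e)) ∧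
        ∀ k, |fderiv ℝ (stateFun (Q k)) x e| ≤ M * ‖e‖ := by
  have hv' : Continuous (fderiv ℝ v) := hv.continuous_fderiv one_ne_zero
  obtain ⟨M, hM⟩ := (hvc.fderiv ℝ).exists_bound_of_continuous hv'
  -- For `x ∈ K`, every `t` with `x - t` in the support of `v` then lies in the ball on which the
  -- kernel is controlled.
  obtain ⟨ρ, hρ, hsub⟩ : ∃ ρ, 0 < ρ ∧ K - tsupport v ⊆ closedBall 0 ρ := by
    have hKs : IsCompact (K - tsupport v) := by
      rw [← Set.sub_image_prod]
      exact (hK.prod hvc).image continuous_sub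
    obtain ⟨ρ, hρ⟩ := hKs.isBounded.subset_closedBall 0
    exact ⟨max ρ 1, by positivity, hρ.trans (closedBall_subset_closedBall (le_max_left _ _))⟩
  obtain ⟨q, hlt, hnn, hq0⟩ := exists_peakPoly n hρ
  have hq : Continuous (stateFun q) := (contDiff_stateFun (k := 0) q).continuous
  have hpow : ∀ k : ℕ, stateFun (q ^ k) = fun t => stateFun q t ^ k := fun k => by
    funext t; simp [stateFun]
  have hmem : ∀ x ∈ K, ∀ t, x - t ∈ tsupport v → t ∈ closedBall (0 : ℝ × (Fin n → ℝ)) ρ := by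
    intro x hx t ht
    have := hsub (Set.sub_mem_sub hx ht)
    rwa [sub_sub_cancel] at this
  choose Q hQ using fun k : ℕ => exists_stateFun_eq_convolution (q ^ k) hv.continuous hvc
  let I : ℕ → ℝ := fun k => (∫ t in closedBall (0 : ℝ × (Fin n → ℝ)) ρ, stateFun q t ^ k)⁻¹
  have hfun : ∀ k, stateFun (C (I k) * Q k) =
      fun x => I k * ((fun t => stateFun q t ^ k) ⋆[lsmul ℝ ℝ, volume] v) x := by
    intro k
    funext x
    rw [← hpow, ← hQ]
    simp [stateFun]
  have hfd : ∀ k x e, fderiv ℝ (stateFun (C (I k) * Q k)) x e =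
      I k * ((fun t => stateFun q t ^ k) ⋆[lsmul ℝ ℝ, volume] fun y => fderiv ℝ v y e) x := by
    intro k x e
    have h := fderiv_convolution_apply (μ := volume) (a := fun t => stateFun q t ^ k) (hq.pow k)
      hv hvc x e
    rw [hfun, (h.1.const_mul (I k)).fderiv, ← h.2]
    rfl
  refine ⟨fun k => C (I k) * Q k, M, fun x hx => ⟨?_, fun e => ⟨?_, fun k => ?_⟩⟩⟩
  · simp only [hfun]
    exact tendsto_inv_integral_mul_convolution hρ hq hlt hnn hq0 hv.continuous
      fun t ht => hmem x hx t (subset_tsupport _ ht)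
  · simp only [hfd]
    refine tendsto_inv_integral_mul_convolution hρ hq hlt hnn hq0 (hv'.clm_apply continuous_const)
      fun t ht => hmem x hx t (support_fderiv_subset ℝ fun h => ht ?_)
    rw [h]; rfl
  · simp only [hfd]
    refine abs_inv_integral_mul_convolution_le hq hnn (fun y => ?_)
      (fun t ht => hmem x hx t (support_fderiv_subset ℝ fun h => ht ?_)) k
    · exact ((fderiv ℝ v y).le_opNorm e).trans (mul_le_mul_of_nonneg_right (hM y) (norm_nonneg e))
    · rw [h]; rfl

/-- Polynomial approximation of a `C¹` function and of its derivative, boundedly and pointwise on a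
compact set. -/
theorem exists_stateFun_tendsto {v : ℝ × (Fin n → ℝ) → ℝ} (hv : ContDiff ℝ 1 v)
    {K : Set (ℝ × (Fin n → ℝ))} (hK : IsCompact K) :
    ∃ (Q : ℕ → MvPolynomial (StateVar n) ℝ) (M : ℝ), ∀ x ∈ K,
      Tendsto (fun k => stateFun (Q k) x) atTop (𝓝 (v x)) ∧
      ∀ e, Tendsto (fun k => fderiv ℝ (stateFun (Q k)) x e) atTop (𝓝 (fderiv ℝ v x e)) ∧
        ∀ k, |fderiv ℝ (stateFun (Q k)) x e| ≤ M * ‖e‖ := by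
  obtain ⟨ρ, hρ, hsub⟩ : ∃ ρ, 0 < ρ ∧ K ⊆ ball 0 ρ := by
    obtain ⟨ρ, hρ⟩ := hK.isBounded.subset_ball 0
    exact ⟨max ρ 1, by positivity, hρ.trans (ball_subset_ball (le_max_left _ _))⟩
  -- The cutoff equals `1` near each point of `K`, so it changes neither `v` nor its derivative
  -- there.
  let χ : ContDiffBump (0 : ℝ × (Fin n → ℝ)) := ⟨ρ, ρ + 1, hρ, by linarith⟩
  have hχ : ContDiff ℝ 1 fun x => χ x * v x := χ.contDiff.mul hv
  obtain ⟨Q, M, h⟩ := exists_stateFun_tendsto_of_hasCompactSupport hχ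
    (χ.hasCompactSupport.mul_right) hK
  refine ⟨Q, M, fun x hx => ?_⟩
  have heq : (fun x => χ x * v x) =ᶠ[𝓝 x] v := by
    filter_upwards [χ.eventuallyEq_one_of_mem_ball (hsub hx)] with y hy
    simp [hy]
  have := h x hx
  rwa [heq.fderiv_eq, show χ x * v x = v x from heq.self_of_nhds] at this

end PolynomialApproximation

/-! ### Localizing matrices and positivity on squares. -/

section LocalizingMatrix

variable {σ : Type*}

theorem localizingMatrix_quadraticForm (d : ℕ) (g : MvPolynomial σ ℝ) (z : (σ →₀ ℕ) → ℝ)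
    (x : {α : σ →₀ ℕ // α.degree ≤ d} →₀ ℝ) :
    (x.sum fun i xi => x.sum fun j xj => star xi * localizingMatrix d g z i j * xj) =
      rieszLin z (g * ((x.sum fun α a => monomial α.1 a) * x.sum fun α a => monomial α.1 a)) := by
  simp only [Finsupp.sum]
  rw [Finset.sum_mul_sum]
  simp only [Finset.mul_sum, map_sum]
  refine Finset.sum_congr rfl fun i _ => Finset.sum_congr rfl fun j _ => ?_
  have e : g * (monomial i.1 (x i) * monomial j.1 (x j)) =
      (x i * x j) • (g * monomial (i.1 + j.1) 1) := by
    rw [monomial_mul, ← mul_smul_comm, smul_monomial, smul_eq_mul, mul_one]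
  rw [e, map_smul, rieszLin_apply, localizingMatrix, Matrix.of_apply, star_trivial, smul_eq_mul]
  ring

theorem exists_finsupp_sum_monomial_eq (q : MvPolynomial σ ℝ) :
    ∃ x : {α : σ →₀ ℕ // α.degree ≤ q.totalDegree} →₀ ℝ,
      (x.sum fun α a => monomial α.1 a) = q := by
  have hdeg : ∀ s ∈ q.support, s.degree ≤ q.totalDegree := fun s hs => le_totalDegree hs
  refine ⟨∑ s ∈ q.support.attach, Finsupp.single ⟨s.1, hdeg s.1 s.2⟩ (q.coeff s.1), ?_⟩
  rw [← Finsupp.sum_finsetSum_index (by simp) (by simp)]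
  simp only [map_zero, Finsupp.sum_single_index]
  rw [Finset.sum_attach q.support fun s => monomial s (q.coeff s), support_sum_monomial_coeff]

/-- The quadratic form of the matrix at the coefficient vector of `q` is `L (g q²)`, and every `q`
fits into some order `d`. -/
theorem forall_posSemidef_localizingMatrix_iff (g : MvPolynomial σ ℝ) (z : (σ →₀ ℕ) → ℝ) :
    (∀ d, (localizingMatrix d g z).PosSemidef) ↔ ∀ q, 0 ≤ rieszLin z (g * (q * q)) := by
  constructor
  · intro h q
    obtain ⟨x, hx⟩ := exists_finsupp_sum_monomial_eq q
    have := (h q.totalDegree).2 x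
    rwa [localizingMatrix_quadraticForm, hx] at this
  · refine fun h d => ⟨?_, fun x => ?_⟩
    · ext i j
      simp [localizingMatrix, add_comm]
    · rw [localizingMatrix_quadraticForm]
      exact h _

end LocalizingMatrix

/-! ### Coordinates, and formal versus analytic derivatives. -/

section Coordinates

variable {n m : ℕ}

/-- The point with given coordinates. -/
def ofCoords (a : Var n m → ℝ) : Pt n m :=
  (a (Sum.inl (Sum.inl ())), fun k => a (Sum.inl (Sum.inr k)), a (Sum.inr (Sum.inl ())),
    fun j => a (Sum.inr (Sum.inr j)))

theorem coords_ofCoords (a : Var n m → ℝ) : coords (ofCoords a) = a := by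
  funext v
  rcases v with (v | v) | (v | v) <;> rfl

theorem ofCoords_coords (x : Pt n m) : ofCoords (coords x) = x := rfl

theorem continuous_ofCoords : Continuous (ofCoords : (Var n m → ℝ) → Pt n m) := by
  unfold ofCoords
  fun_prop

theorem continuous_coords : Continuous (coords : Pt n m → Var n m → ℝ) := by
  refine continuous_pi fun v => ?_
  rcases v with (v | v) | (v | v) <;> simp only [coords, stateCoords, Sum.elim_inl, Sum.elim_inr] <;>
    fun_prop

theorem continuous_eval_coords (q : MvPolynomial (Var n m) ℝ) :
    Continuous fun x : Pt n m => eval (coords x) q :=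
  (continuous_eval q).comp continuous_coords

theorem fderiv_stateFun (q : MvPolynomial (StateVar n) ℝ) (x e : ℝ × (Fin n → ℝ)) :
    fderiv ℝ (stateFun q) x e = ∑ i, stateCoords e.1 e.2 i * stateFun (pderiv i q) x := by
  have hd : ∀ p : MvPolynomial (StateVar n) ℝ, DifferentiableAt ℝ (stateFun p) x := fun p =>
    (contDiff_stateFun (k := 1) p).differentiable one_ne_zero x
  have hX : ∀ j : StateVar n, fderiv ℝ (stateFun (X j)) x e = stateCoords e.1 e.2 j := by
    intro j
    rcases j with j | j
    · have : stateFun (X (Sum.inl j) : MvPolynomial (StateVar n) ℝ) =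
          ContinuousLinearMap.fst ℝ ℝ (Fin n → ℝ) := by
        funext y; simp [stateFun, stateCoords]
      rw [this, ContinuousLinearMap.fderiv]
      rfl
    · have : stateFun (X (Sum.inr j) : MvPolynomial (StateVar n) ℝ) =
          (ContinuousLinearMap.proj j).comp (ContinuousLinearMap.snd ℝ ℝ (Fin n → ℝ)) := by
        funext y; simp [stateFun, stateCoords]
      rw [this, ContinuousLinearMap.fderiv]
      rfl
  induction q using MvPolynomial.induction_on with
  | C a =>
    have : stateFun (C a : MvPolynomial (StateVar n) ℝ) = fun _ => a := by
      funext y; simp [stateFun]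
    rw [this]
    simp [stateFun]
  | add p q hp hq =>
    have : stateFun (p + q) = fun y => stateFun p y + stateFun q y := by
      funext y; simp [stateFun]
    rw [this, fderiv_fun_add (hd p) (hd q), add_apply, hp, hq, ← Finset.sum_add_distrib]
    exact Finset.sum_congr rfl fun i _ => by simp [stateFun, mul_add]
  | mul_X p j hp =>
    have : stateFun (p * X j) = fun y => stateFun p y * stateFun (X j) y := by
      funext y; simp [stateFun]
    rw [this, fderiv_fun_mul (hd p) (hd (X j)), add_apply, smul_apply, smul_apply, hp, hX,
      smul_eq_mul, smul_eq_mul, Finset.mul_sum]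
    have e1 : ∀ i, stateCoords e.1 e.2 i * stateFun (pderiv i (p * X j)) x =
        stateFun (X j) x * (stateCoords e.1 e.2 i * stateFun (pderiv i p) x) +
          if i = j then stateFun p x * stateCoords e.1 e.2 i else 0 := by
      intro i
      rw [Derivation.leibniz, pderiv_X]
      by_cases h : i = j
      · subst h
        simp [stateFun]
        ring
      · simp [stateFun, h, Ne.symm h]
        ring
    simp only [e1, Finset.sum_add_distrib, Finset.sum_ite_eq', Finset.mem_univ, if_true]
    ring

end Coordinates

/-! ### The weak dynamics for polynomial test functions. -/

namespace ControlData

variable {n m : ℕ} (P : ControlData n m)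

/-- The polynomial `∂v/∂t · w₀ ^ p + ∂v/∂y · f̂`, as a linear function of the polynomial `v`. -/
noncomputable def dynamicsMap :
    MvPolynomial (StateVar n) ℝ →ₗ[ℝ] MvPolynomial (Var n m) ℝ where
  toFun q := rename Sum.inl (pderiv (Sum.inl ()) q) * X (Sum.inr (Sum.inl ())) ^ P.p +
    ∑ k : Fin n, rename Sum.inl (pderiv (Sum.inr k) q) * P.fHat k
  map_add' p q := by
    simp only [map_add, add_mul, Finset.sum_add_distrib]
    abel
  map_smul' c q := by
    simp only [Derivation.map_smul, map_smul, smul_mul_assoc, smul_add, Finset.smul_sum,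
      RingHom.id_apply]

theorem dynamicsMap_monomial (α : StateVar n →₀ ℕ) :
    P.dynamicsMap (monomial α 1) = P.dynamicsPoly α := rfl

theorem eval_dynamicsMap (q : MvPolynomial (StateVar n) ℝ) (x : Pt n m) :
    eval (coords x) (P.dynamicsMap q) = P.weakIntegrand (stateFun q) x := by
  have hren : ∀ p : MvPolynomial (StateVar n) ℝ,
      eval (coords x) (rename Sum.inl p) = stateFun p (x.1, x.2.1) := fun p => by
    rw [eval_rename]
    rfl
  have hw : eval (coords x) (X (Sum.inr (Sum.inl ()))) = x.2.2.1 := by simp [coords]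
  simp only [dynamicsMap, LinearMap.coe_mk, AddHom.coe_mk, map_add, map_mul, map_sum, map_pow,
    hw, hren, weakIntegrand, fderiv_stateFun, Fintype.sum_sum_type, stateCoords,
    Sum.elim_inl, Sum.elim_inr]
  simp [mul_comm]

theorem continuous_weakIntegrand {v : ℝ × (Fin n → ℝ) → ℝ} (hv : ContDiff ℝ 1 v) :
    Continuous (P.weakIntegrand (m := m) v) := by
  have h := hv.continuous_fderiv one_ne_zero
  have hf : ∀ k, Continuous fun x : Pt n m => eval (coords x) (P.fHat k) := fun k =>
    continuous_eval_coords _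
  unfold weakIntegrand
  fun_prop

end ControlData

/-! ### Passing between feasible measures and feasible moments. -/

section Equivalence

open Filter Topology

variable {n m : ℕ}

theorem integrable_of_compl_null {μ : Measure (Pt n m)} [IsFiniteMeasure μ] {A : Set (Pt n m)}
    (hA : IsCompact A) (hμ : μ Aᶜ = 0) {h : Pt n m → ℝ} (hh : Continuous h) : Integrable h μ := by
  have := hh.continuousOn.integrableOn_compact (μ := μ) hA
  rwa [IntegrableOn, Measure.restrict_eq_self_of_ae_mem hμ] at this

/-- The moments of a finite measure on a compact set. -/
theorem riesz_moments {μ : Measure (Pt n m)} [IsFiniteMeasure μ] {A : Set (Pt n m)}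
    (hA : IsCompact A) (hμ : μ Aᶜ = 0) (q : MvPolynomial (Var n m) ℝ) :
    riesz (fun s => ∫ x, eval (coords x) (monomial s 1) ∂μ) q = ∫ x, eval (coords x) q ∂μ := by
  have hint : ∀ q : MvPolynomial (Var n m) ℝ, Integrable (fun x => eval (coords x) q) μ :=
    fun q => integrable_of_compl_null hA hμ (continuous_eval_coords q)
  let L : MvPolynomial (Var n m) ℝ →ₗ[ℝ] ℝ :=
    { toFun := fun q => ∫ x, eval (coords x) q ∂μ
      map_add' := fun p q => by
        simp only [map_add]
        exact integral_add (hint p) (hint q)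
      map_smul' := fun c q => by
        simp only [smul_eval, integral_const_mul, RingHom.id_apply, smul_eq_mul] }
  rw [← rieszLin_apply]
  exact congrArg (fun L => L q) (rieszLin_of_linearMap L)

variable (P : ControlData n m) {N : ℕ} {g : Fin N → MvPolynomial (Var n m) ℝ}

namespace ControlData

/-- The weak dynamics for polynomial test functions imply the weak dynamics for `C¹` ones. -/
theorem dynamics_of_polynomial {μ : Measure (Pt n m)} [IsFiniteMeasure μ] (hA : IsCompact P.G)
    (hμ : μ P.Gᶜ = 0)
    (h : ∀ q, ∫ x, P.weakIntegrand (stateFun q) x ∂μ =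
      stateFun q (P.t_f, P.y_f) - stateFun q (P.t₀, P.y₀))
    {v : ℝ × (Fin n → ℝ) → ℝ} (hv : ContDiff ℝ 1 v) :
    ∫ x, P.weakIntegrand v x ∂μ = v (P.t_f, P.y_f) - v (P.t₀, P.y₀) := by
  -- The two boundary points are adjoined so that the right-hand side converges too.
  let K : Set (ℝ × (Fin n → ℝ)) :=
    (fun x : Pt n m => (x.1, x.2.1)) '' P.G ∪ {(P.t_f, P.y_f), (P.t₀, P.y₀)}
  have hK : IsCompact K := (hA.image (by fun_prop)).union (Set.toFinite _).isCompact
  obtain ⟨Q, M, hQ⟩ := exists_stateFun_tendsto hv hK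
  have hf : ∀ k, Continuous fun x : Pt n m => eval (coords x) (P.fHat k) := fun k =>
    continuous_eval_coords _
  have hlim : Tendsto (fun k => ∫ x, P.weakIntegrand (stateFun (Q k)) x ∂μ) atTop
      (𝓝 (∫ x, P.weakIntegrand v x ∂μ)) := by
    refine tendsto_integral_of_dominated_convergence
      (fun x => M * ‖((1, 0) : ℝ × (Fin n → ℝ))‖ * |x.2.2.1 ^ P.p| +
        M * ‖((0, fun k => eval (coords x) (P.fHat k)) : ℝ × (Fin n → ℝ))‖)
      (fun k => (P.continuous_weakIntegrand (contDiff_stateFun _)).aestronglyMeasurable)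
      (integrable_of_compl_null hA hμ (by fun_prop)) (fun k => ?_) ?_
    · have : ∀ᵐ x ∂μ, x ∈ P.G := hμ
      filter_upwards [this] with x hx
      have hx' := (hQ (x.1, x.2.1) (Or.inl ⟨x, hx, rfl⟩)).2
      refine (norm_add_le _ _).trans ?_
      rw [Real.norm_eq_abs, Real.norm_eq_abs, abs_mul]
      exact add_le_add (mul_le_mul_of_nonneg_right ((hx' _).2 k) (abs_nonneg _)) ((hx' _).2 k)
    · have : ∀ᵐ x ∂μ, x ∈ P.G := hμ
      filter_upwards [this] with x hx
      have hx' := (hQ (x.1, x.2.1) (Or.inl ⟨x, hx, rfl⟩)).2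
      exact ((hx' _).1.mul_const _).add (hx' _).1
  simp only [h] at hlim
  exact tendsto_nhds_unique hlim
    ((hQ _ (Or.inr (by simp))).1.sub (hQ _ (Or.inr (by simp))).1)

theorem image_ofCoords_nonnegSet (hG : P.G = {x | ∀ i, 0 ≤ eval (coords x) (g i)}) :
    ofCoords '' nonnegSet (insert 1 (Set.range g)) = P.G := by
  rw [hG]
  ext x
  constructor
  · rintro ⟨a, ha, rfl⟩ i
    rw [coords_ofCoords]
    exact ha _ (Or.inr ⟨i, rfl⟩)
  · refine fun hx => ⟨coords x, ?_, ofCoords_coords x⟩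
    rintro _ (rfl | ⟨i, rfl⟩)
    · simp
    · exact hx i

theorem isFeasibleMoments_of_isFeasibleMeasure
    (hG : P.G = {x | ∀ i, 0 ≤ eval (coords x) (g i)}) (hA : IsCompact P.G)
    {μ : Measure (Pt n m)} (hμ : P.IsFeasibleMeasure μ) :
    P.IsFeasibleMoments g fun s => ∫ x, eval (coords x) (monomial s 1) ∂μ := by
  have := hμ.finite
  have hr := riesz_moments hA hμ.support
  have hmem : ∀ᵐ x ∂μ, x ∈ P.G := hμ.support
  refine ⟨fun α => ?_, ?_, fun d i => ?_⟩
  · rw [hr, ← dynamicsMap_monomial]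
    simp only [eval_dynamicsMap]
    exact hμ.dynamics _ (contDiff_stateFun _)
  · rw [forall_posSemidef_localizingMatrix_iff]
    intro q
    rw [rieszLin_apply, hr]
    refine integral_nonneg fun x => ?_
    simpa using mul_self_nonneg _
  · revert d
    rw [forall_posSemidef_localizingMatrix_iff]
    intro q
    rw [rieszLin_apply, hr]
    refine integral_nonneg_of_ae (hmem.mono fun x hx => ?_)
    rw [hG] at hx
    simpa using mul_nonneg (hx i) (mul_self_nonneg _)

/-- Semidefiniteness yields a representing measure; the dynamics pass from monomials to polynomials
by linearity and to `C¹` functions by approximation. Equality of all polynomial integrals keeps the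
objective. -/
theorem exists_isFeasibleMeasure_of_isFeasibleMoments
    (hG : P.G = {x | ∀ i, 0 ≤ eval (coords x) (g i)})
    (hball : ∃ (i : Fin N) (r : ℝ), g i = C r - ∑ v, X v ^ 2) {z : (Var n m →₀ ℕ) → ℝ}
    (hz : P.IsFeasibleMoments g z) :
    ∃ μ : Measure (Pt n m), P.IsFeasibleMeasure μ ∧
      ∀ q, ∫ x, eval (coords x) q ∂μ = riesz z q := by
  obtain ⟨i, r, hi⟩ := hball
  have h1 : (1 : MvPolynomial (Var n m) ℝ) ∈ insert 1 (Set.range g) := Set.mem_insert _ _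
  have hr : C r - ∑ v, X v ^ 2 ∈ insert 1 (Set.range g) := Or.inr ⟨i, hi⟩
  have hpos : PosOn (insert 1 (Set.range g)) (rieszLin z) := by
    rintro _ (rfl | ⟨i, rfl⟩)
    · exact (forall_posSemidef_localizingMatrix_iff 1 z).1 hz.moment
    · exact (forall_posSemidef_localizingMatrix_iff (g i) z).1 fun d => hz.localizing d i
  have himage := P.image_ofCoords_nonnegSet hG
  have hA : IsCompact P.G := himage ▸ (isCompact_nonnegSet hr).image continuous_ofCoords
  obtain ⟨ν, hν, hsupp, hint⟩ := exists_measure_of_posOn h1 hr hpos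
  have hmeas : Measurable (ofCoords : (Var n m → ℝ) → Pt n m) := continuous_ofCoords.measurable
  have hmap : ∀ q, ∫ x, eval (coords x) q ∂(ν.map ofCoords) = riesz z q := by
    intro q
    rw [integral_map hmeas.aemeasurable (continuous_eval_coords q).aestronglyMeasurable, hint]
    simp only [coords_ofCoords]
  have hnull : ν.map ofCoords P.Gᶜ = 0 := by
    rw [Measure.map_apply hmeas hA.isClosed.measurableSet.compl]
    refine measure_mono_null (Set.compl_subset_compl.2 fun a ha' => ?_) hsupp
    change ofCoords a ∈ P.G
    exact himage ▸ Set.mem_image_of_mem _ ha'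
  have hlin : rieszLin z ∘ₗ P.dynamicsMap =
      (aeval (stateCoords P.t_f P.y_f) : MvPolynomial (StateVar n) ℝ →ₐ[ℝ] ℝ).toLinearMap -
        (aeval (stateCoords P.t₀ P.y₀) : MvPolynomial (StateVar n) ℝ →ₐ[ℝ] ℝ).toLinearMap := by
    refine (basisMonomials _ ℝ).ext fun α => ?_
    have := hz.dynamics α
    rw [← rieszLin_apply, ← dynamicsMap_monomial] at this
    simpa [coe_basisMonomials, coe_aeval_eq_eval] using this
  refine ⟨ν.map ofCoords, ⟨inferInstance, hnull, fun v hv => ?_⟩, hmap⟩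
  refine P.dynamics_of_polynomial hA hnull (fun q => ?_) hv
  have h := congrArg (fun L => L q) hlin
  simp only [← eval_dynamicsMap]
  rw [hmap, ← rieszLin_apply]
  exact h

end ControlData

end Equivalence

end MomentControl

theorem mainTheorem3 {n m : ℕ} (P : MomentControl.ControlData n m)
    (hp : Even P.p) (hp0 : 0 < P.p) (hT : P.t₀ < P.t_f)
    (hy₀ : P.y₀ ∈ P.Y) (hy_f : P.y_f ∈ P.Y)
    (hl : MomentControl.ControlDegreeLE P.p P.l)
    (hf : ∀ k, MomentControl.ControlDegreeLE P.p (P.f k))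
    {N : ℕ} (g : Fin N → MvPolynomial (MomentControl.Var n m) ℝ)
    (hG : P.G = {x | ∀ i, 0 ≤ MvPolynomial.eval (MomentControl.coords x) (g i)})
    (hball : ∃ (i : Fin N) (r : ℝ), g i = MvPolynomial.C r - ∑ v, MvPolynomial.X v ^ 2) :
    P.measureValue = P.momentValue g := by
  have hA : IsCompact P.G := by
    obtain ⟨i, r, hi⟩ := hball
    rw [← P.image_ofCoords_nonnegSet hG]
    exact (MomentControl.isCompact_nonnegSet (r := r) (Or.inr ⟨i, hi⟩)).image
      MomentControl.continuous_ofCoords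
  -- Each feasible point of one problem is matched by one of the other with the same cost, which
  -- also covers infeasibility and unboundedness.
  refine le_antisymm (le_iInf fun z => ?_) (le_iInf fun μ => ?_)
  · obtain ⟨μ, hμ, hint⟩ := P.exists_isFeasibleMeasure_of_isFeasibleMoments hG hball z.2
    refine (iInf_le _ ⟨μ, hμ⟩).trans (le_of_eq ?_)
    rw [hint]
  · have := μ.2.finite
    refine (iInf_le _ ⟨_, P.isFeasibleMoments_of_isFeasibleMeasure hG hA μ.2⟩).trans (le_of_eq ?_)
    rw [MomentControl.riesz_moments hA μ.2.support]
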